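/- **Theorem 1.** The evaluation problem for inclusive nfer (inc-nfer) is undecidable. *Setting.* Let $\mathcal I$ be a set of identifiers. A *map* is a partial function $M:\mathcal I\rightharpoonup\mathbb N\cup\{\mathit{true},\mathit{false}\}$. An *event* is a triple $(\eta,t,M)$ and an *interval* is a tuple $(\eta,s,e,M)$, where $\eta\in\mathcal I$, $t,s,e\in\mathbb N$, $s\le e$ and $M$ is a map; all maps in events are finite. A *trace* is a finite sequence of events, and a *pool* is a set of intervals. An *inclusive rule* $\eta\leftarrow\eta_1\oplus\eta_2\ \mathbf{where}\ \Phi\ \mathbf{map}\ \Psi$ consists of identifiers $\eta,\eta_1,\eta_2$, a clock predicate $\oplus$, a map predicate $\Phi$ (from pairs of maps to Booleans) and a map update $\Psi$ (from pairs of maps to maps). Both $\Phi$ and $\Psi$ are given by expressions over the values of the two maps, built from constants, $+,-,\cdot$, integer division, modulo, the comparisons $<,\le,>,\ge,=$ on natural numbers and the Boolean operators $\wedge,\vee,\neg$. Here subtraction is truncated at $0$. Division by zero, remainders modulo zero, undefined map values, and operations applied to values of the wrong kind make an expression undefined; a predicate with undefined value is not satisfied, and an updated map is undefined at every key whose expression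 is undefined and at every key to which nothing is assigned. The clock predicate relates the produced interval, with timestamps $[s,e]$, to the two matched intervals $[s_1,e_1]$, $[s_2,e_2]$: * before: $e_1<s_2$ and $[s,e]=[s_1,e_2]$; * meet: $e_1=s_2$ and $[s,e]=[s_1,e_2]$; * during: $s_2\le s_1$, $e_1\le e_2$ and $[s,e]=[s_2,e_2]$; * coincide: $s_1=s_2$, $e_1=e_2$ and $[s,e]=[s_1,e_1]$; * start: $s_1=s_2$ and $[s,e]=[s_1,\max(e_1,e_2)]$; * finish: $e_1=e_2$ and $[s,e]=[\min(s_1,s_2),e_1]$; * overlap: $s_1<e_2$, $s_2<e_1$ and $[s,e]=[\min(s_1,s_2),\max(e_1,e_2)]$; * slice: $s_1<e_2$, $s_2<e_1$ and $[s,e]=[\max(s_1,s_2),\min(e_1,e_2)]$. Applied to a pool $\pi$, a rule yields the set $R[\![\delta]\!]\pi$ of all intervals labeled $\eta$ with map $\Psi(M_1,M_2)$ and with timestamps as prescribed by $\oplus$, for all $i_1,i_2\in\pi$ labeled $\eta_1,\eta_2$ with maps $M_1,M_2$ that satisfy $\oplus$ and $\Phi(M_1,M_2)$. A *specification* $D=\delta_1\cdots\delta_n$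 is a finite list of such rules (cycles among the rules are allowed, and there are no exclusive rules). $S[\![D]\!]\pi$ is obtained from $\pi$ by replacing, for $j=1,\dots,n$ in order, the current pool $\pi'$ by $\pi'\cup R[\![\delta_j]\!]\pi'$. For a trace $\tau$, let $\pi_1=\{(\eta,t,t,M):(\eta,t,M)\text{ occurs in }\tau\}$, $\pi_{j+1}=S[\![D]\!]\pi_j$, and $T[\![D]\!]\tau=\bigcup_{j>0}\pi_j$. The *evaluation problem* is: given a specification $D$, a trace $\tau$ and a target identifier $\eta_T$, does $T[\![D]\!]\tau$ contain an interval labeled $\eta_T$? *Claim.* No algorithm decides the evaluation problem. This holds when the finitely many identifiers of an instance are drawn from the countable supply $\mathcal I=\mathbb N$, and there is also a fixed finite set $\mathcal I$ of identifiers for which it holds. -/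

import Mathlib

namespace Nfer

/-- Data values: natural numbers and Booleans. -/
abbrev Value := ℕ ⊕ Bool

/-- The partial functions from identifiers to data values (`none` means undefined). -/
abbrev Map (I : Type) := I → Option Value

/-- A finite list of bindings. It is the finite presentation of a map; if a key occurs more than
once, its first binding counts. -/
abbrev MapData (I : Type) := List (I × Value)

/-- The map presented by a list of bindings. -/
def MapData.toMap {I : Type} [DecidableEq I] (l : MapData I) : Map I := fun x => l.lookup x

/-- An event: an identifier, a timestamp and a map. -/
abbrev Event (I : Type) := I × ℕ × MapData I

/-- A trace is a finite sequence of events. -/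
abbrev Trace (I : Type) := List (Event I)

/-- An interval: an identifier, start and end timestamps, and a map. -/
structure Interval (I : Type) where
  id : I
  startTime : ℕ
  endTime : ℕ
  le : startTime ≤ endTime
  map : Map I

/-- A pool is a set of intervals. -/
abbrev Pool (I : Type) := Set (Interval I)

/-! ### Clock predicates -/

/-- The clock predicates of inclusive rules. -/
inductive ClockPred
  | before | meet | during | coincide | start | finish | overlap | slice

/-- `c.holds i i₁ i₂`: the matched intervals `i₁` (left) and `i₂` (right) are in the temporal
relation `c`, and `i` has the timestamps that `c` prescribes for the produced interval. -/
def ClockPred.holds {I : Type} (c : ClockPred) (i i₁ i₂ : Interval I) : Prop :=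
  match c with
  | .before => i₁.endTime < i₂.startTime ∧ i.startTime = i₁.startTime ∧ i.endTime = i₂.endTime
  | .meet => i₁.endTime = i₂.startTime ∧ i.startTime = i₁.startTime ∧ i.endTime = i₂.endTime
  | .during => i₂.startTime ≤ i₁.startTime ∧ i₁.endTime ≤ i₂.endTime ∧
      i.startTime = i₂.startTime ∧ i.endTime = i₂.endTime
  | .coincide => i₁.startTime = i₂.startTime ∧ i₁.endTime = i₂.endTime ∧
      i.startTime = i₁.startTime ∧ i.endTime = i₁.endTime
  | .start => i₁.startTime = i₂.startTime ∧
      i.startTime = i₁.startTime ∧ i.endTime = max i₁.endTime i₂.endTime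
  | .finish => i₁.endTime = i₂.endTime ∧
      i.startTime = min i₁.startTime i₂.startTime ∧ i.endTime = i₁.endTime
  | .overlap => i₁.startTime < i₂.endTime ∧ i₂.startTime < i₁.endTime ∧
      i.startTime = min i₁.startTime i₂.startTime ∧ i.endTime = max i₁.endTime i₂.endTime
  | .slice => i₁.startTime < i₂.endTime ∧ i₂.startTime < i₁.endTime ∧
      i.startTime = max i₁.startTime i₂.startTime ∧ i.endTime = min i₁.endTime i₂.endTime

/-! ### Map predicates and map updates -/

/-- The binary operations available in map predicates and map updates. -/
inductive Op
  | add | sub | mul | div | mod | lt | le | gt | ge | eq | and | or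

/-- Arithmetic and comparisons act on natural numbers, `and` and `or` on Booleans. Subtraction is
truncated at zero and division is integer division. Division by zero, remainder modulo zero and
the application of an operation to values of the wrong kind are undefined. -/
def Op.apply : Op → Value → Value → Option Value
  | .add, .inl a, .inl b => some (.inl (a + b))
  | .sub, .inl a, .inl b => some (.inl (a - b))
  | .mul, .inl a, .inl b => some (.inl (a * b))
  | .div, .inl a, .inl b => if b = 0 then none else some (.inl (a / b))
  | .mod, .inl a, .inl b => if b = 0 then none else some (.inl (a % b))
  | .lt, .inl a, .inl b => some (.inr (decide (a < b)))
  | .le, .inl a, .inl b => some (.inr (decide (a ≤ b)))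
  | .gt, .inl a, .inl b => some (.inr (decide (a > b)))
  | .ge, .inl a, .inl b => some (.inr (decide (a ≥ b)))
  | .eq, .inl a, .inl b => some (.inr (decide (a = b)))
  | .and, .inr a, .inr b => some (.inr (a && b))
  | .or, .inr a, .inr b => some (.inr (a || b))
  | _, _, _ => none

/-- Expressions over the maps `m₁`, `m₂` of the two matched intervals: constants, the values
`m₁ x` (`left x`) and `m₂ x` (`right x`), negation, and binary operations. -/
inductive Expr (I : Type)
  | const (v : Value)
  | left (x : I)
  | right (x : I)
  | not (e : Expr I)
  | bin (o : Op) (e₁ e₂ : Expr I)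

/-- The value of an expression, `none` if it is undefined. -/
def Expr.eval {I : Type} (m₁ m₂ : Map I) : Expr I → Option Value
  | .const v => some v
  | .left x => m₁ x
  | .right x => m₂ x
  | .not e =>
    match e.eval m₁ m₂ with
    | some (.inr b) => some (.inr (!b))
    | _ => none
  | .bin o e₁ e₂ =>
    (e₁.eval m₁ m₂).bind fun a => (e₂.eval m₁ m₂).bind fun b => o.apply a b

/-- An inclusive rule `id ← id₁ clock id₂ where pred map update`. The map
update assigns expressions to finitely many keys (the first assignment to a key counts). -/
structure Rule (I : Type) where
  id : I
  id₁ : I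
  clock : ClockPred
  id₂ : I
  pred : Expr I
  update : List (I × Expr I)

/-- A specification is a finite list of rules; it may contain cycles. -/
abbrev Spec (I : Type) := List (Rule I)

/-- The map predicate of a rule; a predicate without a defined truth value is not satisfied. -/
def Rule.Phi {I : Type} (δ : Rule I) (m₁ m₂ : Map I) : Prop :=
  δ.pred.eval m₁ m₂ = some (.inr true)

/-- The map update of a rule. The new map is undefined at a key that is not assigned, or whose
assigned expression is undefined. -/
def Rule.Psi {I : Type} [DecidableEq I] (δ : Rule I) (m₁ m₂ : Map I) : Map I :=
  fun x => (δ.update.lookup x).bind fun e => e.eval m₁ m₂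

/-! ### Semantics -/

/-- The intervals that a rule produces from a pool. -/
def Rule.interp {I : Type} [DecidableEq I] (δ : Rule I) (π : Pool I) : Pool I :=
  {i | ∃ i₁ ∈ π, ∃ i₂ ∈ π, i.id = δ.id ∧ i₁.id = δ.id₁ ∧ i₂.id = δ.id₂ ∧
    δ.clock.holds i i₁ i₂ ∧ δ.Phi i₁.map i₂.map ∧ i.map = δ.Psi i₁.map i₂.map}

/-- One pass through a specification: its rules are applied in order, each to the pool extended
by the intervals produced so far. -/
def Spec.step {I : Type} [DecidableEq I] : Spec I → Pool I → Pool I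
  | [], π => π
  | δ :: D, π => Spec.step D (π ∪ δ.interp π)

/-- The initial pool of a trace: one interval of duration zero for every event. -/
def Trace.init {I : Type} [DecidableEq I] (τ : Trace I) : Pool I :=
  {i | ∃ ev ∈ τ, i.id = ev.1 ∧ i.startTime = ev.2.1 ∧ i.endTime = ev.2.1 ∧
    i.map = MapData.toMap ev.2.2}

/-- The pool generated by a specification on a trace: the union of all pools obtained from the
initial pool by iterating passes through the specification. -/
def Spec.interp {I : Type} [DecidableEq I] (D : Spec I) (τ : Trace I) : Pool I :=
  ⋃ n : ℕ, (Spec.step D)^[n] (Trace.init τ)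

/-- An instance of the evaluation problem: a specification, a trace, and a target identifier. -/
abbrev Instance (I : Type) := Spec I × Trace I × I

/-- The evaluation problem: does the generated pool contain an interval that is labeled by the
target identifier? -/
def Evaluation {I : Type} [DecidableEq I] (x : Instance I) : Prop :=
  ∃ i ∈ Spec.interp x.1 x.2.1, i.id = x.2.2

/-! ### Instances as inputs of algorithms

The syntax is given an effective encoding by natural numbers. -/

/-- Numbering of the clock predicates. -/
def ClockPred.equivFin : ClockPred ≃ Fin 8 where
  toFun
    | .before => 0 | .meet => 1 | .during => 2 | .coincide => 3
    | .start => 4 | .finish => 5 | .overlap => 6 | .slice => 7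
  invFun
    | 0 => .before | 1 => .meet | 2 => .during | 3 => .coincide
    | 4 => .start | 5 => .finish | 6 => .overlap | 7 => .slice
  left_inv c := by cases c <;> rfl
  right_inv k := by fin_cases k <;> rfl

instance : Primcodable ClockPred := Primcodable.ofEquiv (Fin 8) ClockPred.equivFin

/-- Numbering of the binary operations. -/
def Op.equivFin : Op ≃ Fin 12 where
  toFun
    | .add => 0 | .sub => 1 | .mul => 2 | .div => 3 | .mod => 4 | .lt => 5
    | .le => 6 | .gt => 7 | .ge => 8 | .eq => 9 | .and => 10 | .or => 11
  invFun
    | 0 => .add | 1 => .sub | 2 => .mul | 3 => .div | 4 => .mod | 5 => .lt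
    | 6 => .le | 7 => .gt | 8 => .ge | 9 => .eq | 10 => .and | 11 => .or
  left_inv o := by cases o <;> rfl
  right_inv k := by fin_cases k <;> rfl

instance : Primcodable Op := Primcodable.ofEquiv (Fin 12) Op.equivFin

/-- Gödel numbering of expressions; the remainder modulo 5 tells the outermost constructor. -/
def Expr.toNat {I : Type} [Encodable I] : Expr I → ℕ
  | .const v => 5 * Encodable.encode v
  | .left x => 5 * Encodable.encode x + 1
  | .right x => 5 * Encodable.encode x + 2
  | .not e => 5 * e.toNat + 3
  | .bin o e₁ e₂ => 5 * Nat.pair (Encodable.encode o) (Nat.pair e₁.toNat e₂.toNat) + 4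

theorem Expr.unpair_lt {n : ℕ} (h : n % 5 = 4) :
    (n / 5).unpair.2.unpair.1 < n ∧ (n / 5).unpair.2.unpair.2 < n := by
  have h1 := Nat.unpair_right_le (n / 5)
  have h2 := Nat.unpair_left_le (n / 5).unpair.2
  have h3 := Nat.unpair_right_le (n / 5).unpair.2
  omega

/-- The expression with a given number. -/
def Expr.ofNat {I : Type} [Encodable I] (n : ℕ) : Option (Expr I) :=
  if n % 5 = 0 then (Encodable.decode (α := Value) (n / 5)).map .const
  else if n % 5 = 1 then (Encodable.decode (α := I) (n / 5)).map .left
  else if n % 5 = 2 then (Encodable.decode (α := I) (n / 5)).map .right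
  else if h3 : n % 5 = 3 then (Expr.ofNat (n / 5)).map .not
  else (Encodable.decode (α := Op) (n / 5).unpair.1).bind fun o =>
    (Expr.ofNat (n / 5).unpair.2.unpair.1).bind fun e₁ =>
      (Expr.ofNat (n / 5).unpair.2.unpair.2).map fun e₂ => .bin o e₁ e₂
termination_by n
decreasing_by
  · omega
  · exact (Expr.unpair_lt (by omega)).1
  · exact (Expr.unpair_lt (by omega)).2

theorem Expr.ofNat_toNat {I : Type} [Encodable I] (e : Expr I) :
    Expr.ofNat e.toNat = some e := by
  induction e with
  | const v => rw [Expr.toNat, Expr.ofNat]; simp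
  | left x =>
    rw [Expr.toNat, Expr.ofNat]
    simp [show ∀ k, (5 * k + 1) / 5 = k by omega]
  | right x =>
    rw [Expr.toNat, Expr.ofNat]
    simp [show ∀ k, (5 * k + 2) / 5 = k by omega]
  | not e ih =>
    rw [Expr.toNat, Expr.ofNat]
    simp [show ∀ k, (5 * k + 3) / 5 = k by omega, ih]
  | bin o e₁ e₂ ih₁ ih₂ =>
    rw [Expr.toNat, Expr.ofNat]
    simp [show ∀ k, (5 * k + 4) / 5 = k by omega, ih₁, ih₂]

instance {I : Type} [Encodable I] : Encodable (Expr I) :=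
  ⟨Expr.toNat, Expr.ofNat, Expr.ofNat_toNat⟩

/-- Recoding of a number through the leaf type `α`. -/
def recode (α : Type) [Encodable α] (n : ℕ) : Option ℕ :=
  (Encodable.decode (α := α) n).map Encodable.encode

theorem primrec_recode (α : Type) [Primcodable α] : Primrec (recode α) :=
  Primrec.option_map Primrec.decode (Primrec.encode.comp Primrec.snd).to₂

/-- Course-of-values step for recoding numbers of expressions. -/
def Expr.recodeStep (I : Type) [Encodable I] (l : List (Option ℕ)) : Option ℕ :=
  if l.length % 5 = 0 then (recode Value (l.length / 5)).map (5 * ·)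
  else if l.length % 5 = 1 then (recode I (l.length / 5)).map (5 * · + 1)
  else if l.length % 5 = 2 then (recode I (l.length / 5)).map (5 * · + 2)
  else if l.length % 5 = 3 then (l.getD (l.length / 5) none).map (5 * · + 3)
  else (recode Op (l.length / 5).unpair.1).bind fun o =>
    (l.getD (l.length / 5).unpair.2.unpair.1 none).bind fun a =>
      (l.getD (l.length / 5).unpair.2.unpair.2 none).map fun b =>
        5 * Nat.pair o (Nat.pair a b) + 4

theorem Expr.recode_eq {I : Type} [Encodable I] (n : ℕ) :
    Expr.recodeStep I ((List.range n).map (recode (Expr I))) = recode (Expr I) n := by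
  have hget : ∀ k, k < n →
      ((List.range n).map (recode (Expr I))).getD k none = recode (Expr I) k := by
    intro k hk
    simp [List.getD, hk]
  have hr : ∀ k, recode (Expr I) k = (Expr.ofNat k).map Expr.toNat := fun _ => rfl
  unfold Expr.recodeStep
  rw [hr n, Expr.ofNat]
  simp only [List.length_map, List.length_range]
  split_ifs with h0 h1 h2 h3
  · simp [recode, Option.map_map, Function.comp_def, Expr.toNat]
  · simp [recode, Option.map_map, Function.comp_def, Expr.toNat]
  · simp [recode, Option.map_map, Function.comp_def, Expr.toNat]
  · rw [hget _ (by omega), hr]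
    simp [Option.map_map, Function.comp_def, Expr.toNat]
  · have h4 := Expr.unpair_lt (n := n) (by omega)
    rw [hget _ h4.1, hget _ h4.2, hr, hr]
    cases h5 : (Encodable.decode (α := Op) (n / 5).unpair.1) <;>
      cases h6 : (Expr.ofNat (n / 5).unpair.2.unpair.1 : Option (Expr I)) <;>
        cases h7 : (Expr.ofNat (n / 5).unpair.2.unpair.2 : Option (Expr I)) <;>
          simp [recode, h5, Expr.toNat]

theorem Expr.primrec_recodeStep (I : Type) [Primcodable I] :
    Primrec (Expr.recodeStep I) := by
  have hlen : Primrec (fun l : List (Option ℕ) => l.length) := Primrec.list_length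
  have hmod : Primrec (fun l : List (Option ℕ) => l.length % 5) :=
    Primrec.nat_mod.comp hlen (Primrec.const 5)
  have hq : Primrec (fun l : List (Option ℕ) => l.length / 5) :=
    Primrec.nat_div.comp hlen (Primrec.const 5)
  have ht : ∀ k : ℕ, PrimrecPred (fun l : List (Option ℕ) => l.length % 5 = k) := fun k =>
    Primrec.eq.comp hmod (Primrec.const k)
  have hlin : ∀ c : ℕ, Primrec (fun k : ℕ => 5 * k + c) := fun c =>
    Primrec.nat_add.comp (Primrec.nat_mul.comp (Primrec.const 5) Primrec.id) (Primrec.const c)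
  have hgetD : Primrec₂ (fun (l : List (Option ℕ)) (k : ℕ) => l.getD k none) :=
    Primrec.list_getD none
  have hu : Primrec (fun l : List (Option ℕ) => (l.length / 5).unpair) :=
    Primrec.unpair.comp hq
  have huu : Primrec (fun l : List (Option ℕ) => (l.length / 5).unpair.2.unpair) :=
    Primrec.unpair.comp (Primrec.snd.comp hu)
  unfold Expr.recodeStep
  refine Primrec.ite (ht 0) ?_ (Primrec.ite (ht 1) ?_ (Primrec.ite (ht 2) ?_
    (Primrec.ite (ht 3) ?_ ?_)))
  · exact Primrec.option_map ((primrec_recode Value).comp hq) ((hlin 0).comp Primrec.snd).to₂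
  · exact Primrec.option_map ((primrec_recode I).comp hq) ((hlin 1).comp Primrec.snd).to₂
  · exact Primrec.option_map ((primrec_recode I).comp hq) ((hlin 2).comp Primrec.snd).to₂
  · exact Primrec.option_map (hgetD.comp Primrec.id hq) ((hlin 3).comp Primrec.snd).to₂
  · refine Primrec.option_bind ((primrec_recode Op).comp (Primrec.fst.comp hu)) ?_
    refine Primrec.option_bind (f := fun p : List (Option ℕ) × ℕ =>
      p.1.getD (p.1.length / 5).unpair.2.unpair.1 none)
      (hgetD.comp Primrec.fst ((Primrec.fst.comp huu).comp Primrec.fst)) ?_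
    refine Primrec.option_map (f := fun p : (List (Option ℕ) × ℕ) × ℕ =>
      p.1.1.getD (p.1.1.length / 5).unpair.2.unpair.2 none)
      (hgetD.comp (Primrec.fst.comp Primrec.fst)
        ((Primrec.snd.comp huu).comp (Primrec.fst.comp Primrec.fst))) ?_
    exact (hlin 4).comp (Primrec₂.natPair.comp
      (Primrec.snd.comp (Primrec.fst.comp Primrec.fst))
      (Primrec₂.natPair.comp (Primrec.snd.comp Primrec.fst) Primrec.snd))

theorem Expr.primrec_recode (I : Type) [Primcodable I] : Primrec (recode (Expr I)) := by
  have h : Primrec₂ (fun (_ : Unit) (n : ℕ) => recode (Expr I) n) :=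
    Primrec.nat_strong_rec (fun (_ : Unit) (n : ℕ) => recode (Expr I) n)
      (g := fun _ l => some (Expr.recodeStep I l))
      (Primrec.option_some.comp ((Expr.primrec_recodeStep I).comp Primrec.snd)).to₂
      (fun _ n => congrArg some (Expr.recode_eq n))
  exact h.comp (Primrec.const ()) Primrec.id

instance {I : Type} [Primcodable I] : Primcodable (Expr I) where
  prim := by
    have h := Primrec.nat_iff.mp (Primrec.encode.comp (Expr.primrec_recode I))
    refine h.of_eq fun n => ?_
    unfold recode
    cases (Encodable.decode (α := Expr I) n) <;> rfl

/-- A rule as the tuple of its components. -/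
def Rule.equivProd (I : Type) :
    Rule I ≃ I × I × ClockPred × I × Expr I × List (I × Expr I) where
  toFun δ := (δ.id, δ.id₁, δ.clock, δ.id₂, δ.pred, δ.update)
  invFun p := ⟨p.1, p.2.1, p.2.2.1, p.2.2.2.1, p.2.2.2.2.1, p.2.2.2.2.2⟩
  left_inv _ := rfl
  right_inv _ := rfl

instance {I : Type} [Primcodable I] : Primcodable (Rule I) :=
  Primcodable.ofEquiv _ (Rule.equivProd I)

end Nfer

/-!
The halting problem for `Nat.Partrec.Code` reduces to evaluation. The big-step semantics of codes
is a system of inference rules, each with at most two premises, for judgements `p(n) = v`, and one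
fixed specification implements it. A judgement is an interval with timestamps `[0, 0]` whose map
holds the number of the code `p`, two numbers `a`, `k` with `n = Nat.pair a k`, and the value `v`.
All rules use the clock predicate `coincide`, so time plays no role and the generated pool is the
closure of the initial pool under the inference rules.

Storing the input in unpaired form lets the conclusion of a rule be computed from its premises
without ever inverting `Nat.pair`, and `Nat.pair` itself is an expression thanks to truncated
subtraction (`Expr.natPair`). The axioms of the system need all numbers as inputs; these are supplied
by the values of judgements already derived, starting from the judgement `zero(0) = 0` in the trace
(`exists_value`).

The only part of an instance that depends on the code `p` in question is a constant in the trace, a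
query interval holding the number of `p`; one further rule produces the target label when the query
matches a judgement about the input `0`. Correctness of the reduction is
`interp_haltingSpec_subset` (soundness: only true judgements are generated) and
`derived_of_mem_eval` (completeness, by induction on the code). Since five identifiers suffice, the
argument works for `Fin 5` and for `ℕ` alike.
-/

namespace Nfer

open Nat.Partrec (Code)
open Nat.Partrec.Code

/-! ### The generated pool as a least fixed point -/

section Closure

variable {I : Type} [DecidableEq I]

theorem Rule.interp_mono (δ : Rule I) {π π' : Pool I} (h : π ⊆ π') : δ.interp π ⊆ δ.interp π' := by
  rintro i ⟨i₁, h₁, i₂, h₂, hi⟩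
  exact ⟨i₁, h h₁, i₂, h h₂, hi⟩

theorem Spec.subset_step (D : Spec I) (π : Pool I) : π ⊆ Spec.step D π := by
  induction D generalizing π with
  | nil => exact subset_rfl
  | cons δ D ih => exact Set.subset_union_left.trans (ih _)

theorem Spec.interp_subset_step {D : Spec I} {δ : Rule I} (hδ : δ ∈ D) (π : Pool I) :
    δ.interp π ⊆ Spec.step D π := by
  induction D generalizing π with
  | nil => simp at hδ
  | cons δ' D ih =>
    rcases List.mem_cons.mp hδ with rfl | hδ
    · exact Set.subset_union_right.trans (Spec.subset_step D _)
    · exact (δ.interp_mono Set.subset_union_left).trans (ih hδ _)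

theorem Spec.step_subset {D : Spec I} {S : Pool I} (hD : ∀ δ ∈ D, δ.interp S ⊆ S) {π : Pool I}
    (hπ : π ⊆ S) : Spec.step D π ⊆ S := by
  induction D generalizing π with
  | nil => exact hπ
  | cons δ D ih =>
    exact ih (fun δ' h => hD δ' (List.mem_cons_of_mem _ h))
      (Set.union_subset hπ ((δ.interp_mono hπ).trans (hD δ List.mem_cons_self)))

theorem Spec.init_subset_interp (D : Spec I) (τ : Trace I) : Trace.init τ ⊆ Spec.interp D τ :=
  Set.subset_iUnion_of_subset 0 subset_rfl

theorem Spec.interp_subset {D : Spec I} {τ : Trace I} {S : Pool I} (hτ : Trace.init τ ⊆ S)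
    (hD : ∀ δ ∈ D, δ.interp S ⊆ S) : Spec.interp D τ ⊆ S := by
  refine Set.iUnion_subset fun n => ?_
  induction n with
  | zero => exact hτ
  | succ n ih =>
    rw [Function.iterate_succ_apply']
    exact Spec.step_subset hD ih

/-- The generated pool is closed under the rules. Two of its intervals occur together in the pool
of some finite stage, since the stages increase. -/
theorem Spec.interp_closed {D : Spec I} {δ : Rule I} (hδ : δ ∈ D) (τ : Trace I) :
    δ.interp (Spec.interp D τ) ⊆ Spec.interp D τ := by
  have hmono : Monotone fun n => (Spec.step D)^[n] (Trace.init τ) :=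
    monotone_nat_of_le_succ fun n => by
      rw [Function.iterate_succ_apply']
      exact Spec.subset_step D _
  rintro i ⟨i₁, h₁, i₂, h₂, hi⟩
  obtain ⟨n₁, h₁⟩ := Set.mem_iUnion.mp h₁
  obtain ⟨n₂, h₂⟩ := Set.mem_iUnion.mp h₂
  refine Set.mem_iUnion.mpr ⟨max n₁ n₂ + 1, ?_⟩
  rw [Function.iterate_succ_apply']
  exact Spec.interp_subset_step hδ _
    ⟨i₁, hmono (le_max_left _ _) h₁, i₂, hmono (le_max_right _ _) h₂, hi⟩

/-- The interval with label `x`, timestamps `[0, 0]` and map `m`. -/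
def Interval.atZero (x : I) (m : Map I) : Interval I := ⟨x, 0, 0, le_rfl, m⟩

theorem Spec.atZero_mem_interp {D : Spec I} {τ : Trace I} {δ : Rule I} (hδ : δ ∈ D)
    (hc : δ.clock = .coincide) {m₁ m₂ : Map I}
    (h₁ : Interval.atZero δ.id₁ m₁ ∈ Spec.interp D τ)
    (h₂ : Interval.atZero δ.id₂ m₂ ∈ Spec.interp D τ) (hΦ : δ.Phi m₁ m₂) :
    Interval.atZero δ.id (δ.Psi m₁ m₂) ∈ Spec.interp D τ := by
  refine Spec.interp_closed hδ τ ⟨_, h₁, _, h₂, rfl, rfl, rfl, ?_, hΦ, rfl⟩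
  rw [hc]
  exact ⟨rfl, rfl, rfl, rfl⟩

end Closure

/-! ### Expressions -/

section Expressions

variable {I : Type}

/-- The constant `n`. -/
abbrev Expr.nat (n : ℕ) : Expr I := .const (.inl n)

/-- The conjunction of two conditions. -/
abbrev Expr.and (e₁ e₂ : Expr I) : Expr I := .bin .and e₁ e₂

/-- Equality of two numbers. -/
abbrev Expr.eq (e₁ e₂ : Expr I) : Expr I := .bin .eq e₁ e₂

/-- The sum of two numbers. -/
abbrev Expr.add (e₁ e₂ : Expr I) : Expr I := .bin .add e₁ e₂

/-- The product of two numbers. -/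
abbrev Expr.mul (e₁ e₂ : Expr I) : Expr I := .bin .mul e₁ e₂

/-- The truncated difference of two numbers. -/
abbrev Expr.sub (e₁ e₂ : Expr I) : Expr I := .bin .sub e₁ e₂

/-- The expression for `Nat.pair a b`, obtained as `M * M + a + (1 - (b - a)) * b` where
`M = a + (b - a)` is the maximum of `a` and `b`. -/
def Expr.natPair (e₁ e₂ : Expr I) : Expr I :=
  .add (.add (.mul (.add e₁ (.sub e₂ e₁)) (.add e₁ (.sub e₂ e₁))) e₁)
    (.mul (.sub (.nat 1) (.sub e₂ e₁)) e₂)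

theorem natPair_eq (a b : ℕ) :
    (a + (b - a)) * (a + (b - a)) + a + (1 - (b - a)) * b = Nat.pair a b := by
  unfold Nat.pair
  split_ifs with h
  · rw [show a + (b - a) = b by omega, show 1 - (b - a) = 0 by omega]
    ring
  · rw [show b - a = 0 by omega]
    ring

/-- The pairing function on data values, undefined on Booleans. -/
def valuePair : Value → Value → Option Value
  | .inl a, .inl b => some (.inl (Nat.pair a b))
  | _, _ => none

@[simp]
theorem valuePair_inl (a b : ℕ) : valuePair (.inl a) (.inl b) = some (.inl (Nat.pair a b)) := rfl

@[simp]
theorem Expr.eval_natPair (m₁ m₂ : Map I) (e₁ e₂ : Expr I) :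
    (Expr.natPair e₁ e₂).eval m₁ m₂ =
      (e₁.eval m₁ m₂).bind fun a => (e₂.eval m₁ m₂).bind fun b => valuePair a b := by
  rcases h₁ : e₁.eval m₁ m₂ with _ | (a | a) <;> rcases h₂ : e₂.eval m₁ m₂ with _ | (b | b) <;>
    simp [Expr.natPair, Expr.eval, h₁, h₂, Op.apply, valuePair, natPair_eq]

end Expressions

theorem lookup_cons {α β : Type} [DecidableEq α] (x y : α) (b : β) (l : List (α × β)) :
    ((y, b) :: l).lookup x = if x = y then some b else l.lookup x := by
  rw [List.lookup]
  by_cases h : x = y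
  · subst h
    simp
  · rw [beq_eq_false_iff_ne.mpr h, if_neg h]

/-! ### The inference rules for codes -/

section Rules

variable {I : Type} (ι : Fin 5 ↪ I)

/-- The rule with two judgements as premises and a judgement as its conclusion. Judgements are
labeled `ι 0`. The keys `ι 0`, `ι 1`, `ι 2`, `ι 3` hold the number `c` of the code, the two
components `a`, `k` of its input, and its value `v`. The list `l` holds further assignments. -/
def judgementRule (pred c a k v : Expr I) (l : List (I × Expr I)) : Rule I where
  id := ι 0
  id₁ := ι 0
  clock := .coincide
  id₂ := ι 0
  pred := pred
  update := (ι 0, c) :: (ι 1, a) :: (ι 2, k) :: (ι 3, v) :: l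

/-- The rule for `zero`. Its input consists of the values of the two premises. -/
def zeroRule : Rule I :=
  judgementRule ι (.const (.inr true)) (.nat 0) (.left (ι 3)) (.right (ι 3)) (.nat 0) []

/-- The rule for `succ`. Its input consists of the values of the two premises. -/
def succRule : Rule I :=
  judgementRule ι (.const (.inr true)) (.nat 1) (.left (ι 3)) (.right (ι 3))
    (.add (.natPair (.left (ι 3)) (.right (ι 3))) (.nat 1)) []

/-- The rule for `left`. Its input consists of the values of the two premises. -/
def leftRule : Rule I :=
  judgementRule ι (.const (.inr true)) (.nat 2) (.left (ι 3)) (.right (ι 3)) (.left (ι 3)) []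

/-- The rule for `right`. Its input consists of the values of the two premises. -/
def rightRule : Rule I :=
  judgementRule ι (.const (.inr true)) (.nat 3) (.left (ι 3)) (.right (ι 3)) (.right (ι 3)) []

/-- The rule for `pair f g`. Its premises are `f(n) = x` and `g(n) = y`. -/
def pairRule : Rule I :=
  judgementRule ι (.and (.eq (.left (ι 1)) (.right (ι 1))) (.eq (.left (ι 2)) (.right (ι 2))))
    (.add (.mul (.nat 4) (.natPair (.left (ι 0)) (.right (ι 0)))) (.nat 4))
    (.left (ι 1)) (.left (ι 2)) (.natPair (.left (ι 3)) (.right (ι 3))) []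

/-- The rule for `comp f g`. Its premises are `g(n) = x` and `f(x) = v`. -/
def compRule : Rule I :=
  judgementRule ι (.eq (.left (ι 3)) (.natPair (.right (ι 1)) (.right (ι 2))))
    (.add (.mul (.nat 4) (.natPair (.right (ι 0)) (.left (ι 0)))) (.nat 6))
    (.left (ι 1)) (.left (ι 2)) (.right (ι 3)) []

/-- The rule for `prec f g` on an input `Nat.pair a 0`. Its first premise is `f(a) = v`, and the
value of the second premise is used as the number of `g`. The latter is stored at the additional
key `ι 4`, for use by `precSuccRule`. -/
def precZeroRule : Rule I :=
  judgementRule ι (.const (.inr true))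
    (.add (.mul (.nat 4) (.natPair (.left (ι 0)) (.right (ι 3)))) (.nat 5))
    (.natPair (.left (ι 1)) (.left (ι 2))) (.nat 0) (.left (ι 3)) [(ι 4, .right (ι 3))]

/-- The rule for `prec f g` on an input `Nat.pair a (k + 1)`. Its premises are
`prec f g (a, k) = x` and `g(a, (k, x)) = v`. The first one must hold the number of `g` at the key
`ι 4`: if the key has no value, then the map predicate is undefined and the rule does not apply. -/
def precSuccRule : Rule I :=
  judgementRule ι (.and (.eq (.left (ι 4)) (.right (ι 0)))
      (.eq (.natPair (.left (ι 1)) (.natPair (.left (ι 2)) (.left (ι 3))))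
        (.natPair (.right (ι 1)) (.right (ι 2)))))
    (.left (ι 0)) (.left (ι 1)) (.add (.left (ι 2)) (.nat 1)) (.right (ι 3))
    [(ι 4, .left (ι 4))]

/-- The rule that ends the search of `rfind' f`. Its premise is `f(a, k) = 0`; the second premise
is arbitrary. -/
def rfindZeroRule : Rule I :=
  judgementRule ι (.eq (.left (ι 3)) (.nat 0))
    (.add (.mul (.nat 4) (.left (ι 0))) (.nat 7)) (.left (ι 1)) (.left (ι 2)) (.left (ι 2)) []

/-- The rule that continues the search of `rfind' f`. Its premises are
`rfind' f (a, k + 1) = v` and `f(a, k) = w` where `w` is positive. -/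
def rfindSuccRule : Rule I :=
  judgementRule ι (.and (.eq (.left (ι 0)) (.add (.mul (.nat 4) (.right (ι 0))) (.nat 7)))
      (.and (.eq (.left (ι 1)) (.right (ι 1)))
        (.and (.eq (.left (ι 2)) (.add (.right (ι 2)) (.nat 1)))
          (.bin .gt (.right (ι 3)) (.nat 0)))))
    (.left (ι 0)) (.left (ι 1)) (.right (ι 2)) (.left (ι 3)) []

/-- The inference rules for judgements. -/
def evalRules : Spec I :=
  [zeroRule ι, succRule ι, leftRule ι, rightRule ι, pairRule ι, compRule ι, precZeroRule ι,
    precSuccRule ι, rfindZeroRule ι, rfindSuccRule ι]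

/-- The rule that produces the target label `ι 2` from a query, labeled `ι 1`, and a judgement
about the code of the query and the input `0`. -/
def targetRule : Rule I where
  id := ι 2
  id₁ := ι 1
  clock := .coincide
  id₂ := ι 0
  pred := .and (.eq (.left (ι 0)) (.right (ι 0)))
    (.eq (.natPair (.right (ι 1)) (.right (ι 2))) (.nat 0))
  update := []

/-- The specification of all instances in the reduction. -/
def haltingSpec : Spec I := targetRule ι :: evalRules ι

/-- The query for the code `p`, and the judgement `zero(0) = 0`. -/
def haltingTrace (p : Code) : Trace I :=
  [(ι 1, 0, [(ι 0, .inl (Encodable.encode p))]),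
    (ι 0, 0, [(ι 0, .inl 0), (ι 1, .inl 0), (ι 2, .inl 0), (ι 3, .inl 0)])]

/-- The instance of the evaluation problem that asks whether `p` halts on the input `0`. -/
def haltingInstance (p : Code) : Instance I := (haltingSpec ι, haltingTrace ι p, ι 2)

/-- The map `m` represents the judgement `p (Nat.pair a k) = v`. -/
def Represents (m : Map I) (p : Code) (a k v : ℕ) : Prop :=
  m (ι 0) = some (.inl (encodeCode p)) ∧ m (ι 1) = some (.inl a) ∧ m (ι 2) = some (.inl k) ∧
    m (ι 3) = some (.inl v)

/-- The map `m` represents a true judgement, and its value at `ι 4`, if there is one, is the number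
of `g` for a code `prec f g`. -/
def Correct (m : Map I) : Prop :=
  ∃ p a k v, Represents ι m p a k v ∧ v ∈ p.eval (Nat.pair a k) ∧
    ∀ w, m (ι 4) = some w → ∃ f g, p = .prec f g ∧ w = .inl (encodeCode g)

end Rules

/-! ### The semantics of codes as a system of inference rules -/

theorem encodeCode_ofNatCode (n : ℕ) : encodeCode (ofNatCode n) = n := by
  rw [← encodeCode_eq, ← ofNatCode_eq]
  exact Denumerable.encode_ofNat n

theorem encodeCode_pair (f g : Code) :
    encodeCode (.pair f g) = 4 * Nat.pair (encodeCode f) (encodeCode g) + 4 := by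
  rw [encodeCode]
  ring

theorem encodeCode_comp (f g : Code) :
    encodeCode (.comp f g) = 4 * Nat.pair (encodeCode f) (encodeCode g) + 6 := by
  rw [encodeCode]
  ring

theorem encodeCode_prec (f g : Code) :
    encodeCode (.prec f g) = 4 * Nat.pair (encodeCode f) (encodeCode g) + 5 := by
  rw [encodeCode]
  ring

theorem encodeCode_rfind (f : Code) : encodeCode (.rfind' f) = 4 * encodeCode f + 7 := by
  rw [encodeCode]
  ring

theorem encodeCode_inj {p q : Code} (h : encodeCode p = encodeCode q) : p = q := by
  rw [← encodeCode_eq] at h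
  exact Encodable.encode_injective h

theorem mem_eval_pair {f g : Code} {n v : ℕ} :
    v ∈ (Code.pair f g).eval n ↔ ∃ x ∈ f.eval n, ∃ y ∈ g.eval n, v = Nat.pair x y := by
  simp [Code.eval, Seq.seq, eq_comm]

theorem mem_eval_comp {f g : Code} {n v : ℕ} :
    v ∈ (Code.comp f g).eval n ↔ ∃ x ∈ g.eval n, v ∈ f.eval x := by
  rw [Code.eval]
  exact Part.mem_bind_iff

theorem mem_eval_prec_succ {f g : Code} {a k v : ℕ} :
    v ∈ (Code.prec f g).eval (Nat.pair a (k + 1)) ↔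
      ∃ x ∈ (Code.prec f g).eval (Nat.pair a k), v ∈ g.eval (Nat.pair a (Nat.pair k x)) := by
  simp [eval_prec_succ]

/-- `rfind' f` starts its search at the second component of the input, and returns the argument found
rather than the number of steps. -/
theorem mem_eval_rfind {f : Code} {a k v : ℕ} :
    v ∈ (Code.rfind' f).eval (Nat.pair a k) ↔
      ∃ j, v = j + k ∧ 0 ∈ f.eval (Nat.pair a (j + k)) ∧
        ∀ i < j, ∃ w > 0, w ∈ f.eval (Nat.pair a (i + k)) := by
  simp only [Code.eval, Nat.unpaired, Nat.unpair_pair, Part.mem_map_iff]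
  constructor
  · rintro ⟨j, hj, rfl⟩
    obtain ⟨h0, hpos⟩ := Nat.mem_rfind.mp hj
    refine ⟨j, rfl, by simpa using h0, fun i hi => ?_⟩
    obtain ⟨w, hw, hw'⟩ := (Part.mem_map_iff _).mp (hpos hi)
    exact ⟨w, Nat.pos_of_ne_zero (by simpa using hw'), hw⟩
  · rintro ⟨j, rfl, h0, hpos⟩
    refine ⟨j, Nat.mem_rfind.mpr ⟨by simpa using h0, fun {i} hi => ?_⟩, rfl⟩
    obtain ⟨w, hw, hw'⟩ := hpos i hi
    exact (Part.mem_map_iff _).mpr ⟨w, hw', by simpa using hw.ne'⟩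

theorem mem_eval_rfind_zero {f : Code} {a k : ℕ} (h : 0 ∈ f.eval (Nat.pair a k)) :
    k ∈ (Code.rfind' f).eval (Nat.pair a k) :=
  mem_eval_rfind.mpr ⟨0, by simp, by simpa using h, by simp⟩

theorem mem_eval_rfind_succ {f : Code} {a k v w : ℕ} (hw : 0 < w)
    (h : w ∈ f.eval (Nat.pair a k)) (hv : v ∈ (Code.rfind' f).eval (Nat.pair a (k + 1))) :
    v ∈ (Code.rfind' f).eval (Nat.pair a k) := by
  obtain ⟨j, rfl, h0, hpos⟩ := mem_eval_rfind.mp hv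
  refine mem_eval_rfind.mpr ⟨j + 1, by ring, ?_, ?_⟩
  · rwa [show j + 1 + k = j + (k + 1) by ring]
  · rintro (_ | i) hi
    · exact ⟨w, hw, by simpa using h⟩
    · rw [show i + 1 + k = i + (k + 1) by ring]
      exact hpos i (by omega)

/-! ### Soundness of the reduction -/

section Soundness

variable {I : Type} [DecidableEq I] (ι : Fin 5 ↪ I)

/-- Every inference rule leads from true judgements to a true judgement. -/
theorem correct_psi {δ : Rule I} (hδ : δ ∈ evalRules ι) {m₁ m₂ : Map I} (h₁ : Correct ι m₁)
    (h₂ : Correct ι m₂) (hΦ : δ.Phi m₁ m₂) : Correct ι (δ.Psi m₁ m₂) := by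
  obtain ⟨p, a, k, v, ⟨hp, ha, hk, hv⟩, he, hg⟩ := h₁
  obtain ⟨q, b, l, w, ⟨hq, hb, hl, hw⟩, he', -⟩ := h₂
  simp only [evalRules, List.mem_cons, List.not_mem_nil, or_false] at hδ
  rcases hδ with rfl | rfl | rfl | rfl | rfl | rfl | rfl | rfl | rfl | rfl
  · refine ⟨.zero, v, w, 0, ?_, ?_, ?_⟩ <;>
      simp [Represents, zeroRule, judgementRule, Rule.Psi, Expr.eval, encodeCode, lookup_cons, hv, hw,
        Code.eval, pure, PFun.pure]
  · refine ⟨.succ, v, w, Nat.pair v w + 1, ?_, ?_, ?_⟩ <;>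
      simp [Represents, succRule, judgementRule, Rule.Psi, Expr.eval, Op.apply, encodeCode,
        lookup_cons, hv, hw, Code.eval]
  · refine ⟨.left, v, w, v, ?_, ?_, ?_⟩ <;>
      simp [Represents, leftRule, judgementRule, Rule.Psi, Expr.eval, encodeCode, lookup_cons, hv, hw,
        Code.eval]
  · refine ⟨.right, v, w, w, ?_, ?_, ?_⟩ <;>
      simp [Represents, rightRule, judgementRule, Rule.Psi, Expr.eval, encodeCode, lookup_cons, hv, hw,
        Code.eval]
  · simp [Rule.Phi, pairRule, judgementRule, Expr.eval, Op.apply, ha, hb, hk, hl] at hΦ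
    obtain ⟨rfl, rfl⟩ := hΦ
    refine ⟨.pair p q, a, k, Nat.pair v w, ?_, mem_eval_pair.mpr ⟨v, he, w, he', rfl⟩, ?_⟩ <;>
      simp [Represents, pairRule, judgementRule, Rule.Psi, Expr.eval, Op.apply, encodeCode_pair,
        lookup_cons, *]
  · simp [Rule.Phi, compRule, judgementRule, Expr.eval, Op.apply, hv, hb, hl] at hΦ
    subst hΦ
    refine ⟨.comp q p, a, k, w, ?_, mem_eval_comp.mpr ⟨_, he, he'⟩, ?_⟩ <;>
      simp [Represents, compRule, judgementRule, Rule.Psi, Expr.eval, Op.apply, encodeCode_comp,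
        lookup_cons, *]
  -- The value `w` of the second premise is the number of a code, as every number is.
  · refine ⟨.prec p (ofNatCode w), Nat.pair a k, 0, v, ?_, ?_, ?_⟩
    · simp [Represents, precZeroRule, judgementRule, Rule.Psi, Expr.eval, Op.apply, encodeCode_prec,
        lookup_cons, encodeCode_ofNatCode, *]
    · simpa using he
    · simp [precZeroRule, judgementRule, Rule.Psi, Expr.eval, lookup_cons, encodeCode_ofNatCode, *]
  · cases hu : m₁ (ι 4) with
    | none => simp [Rule.Phi, precSuccRule, judgementRule, Expr.eval, hu] at hΦ
    | some u =>
      obtain ⟨f, g, rfl, rfl⟩ := hg u hu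
      simp [Rule.Phi, precSuccRule, judgementRule, Expr.eval, Op.apply, *] at hΦ
      obtain ⟨hgq, rfl, rfl⟩ := hΦ
      obtain rfl := encodeCode_inj hgq
      refine ⟨.prec f g, a, k + 1, w, ?_, mem_eval_prec_succ.mpr ⟨v, he, he'⟩, ?_⟩ <;>
        simp [Represents, precSuccRule, judgementRule, Rule.Psi, Expr.eval, Op.apply, lookup_cons, *]
  · simp [Rule.Phi, rfindZeroRule, judgementRule, Expr.eval, Op.apply, hv] at hΦ
    subst hΦ
    refine ⟨.rfind' p, a, k, k, ?_, mem_eval_rfind_zero he, ?_⟩ <;>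
      simp [Represents, rfindZeroRule, judgementRule, Rule.Psi, Expr.eval, Op.apply, encodeCode_rfind,
        lookup_cons, *]
  · simp [Rule.Phi, rfindSuccRule, judgementRule, Expr.eval, Op.apply, *] at hΦ
    obtain ⟨hpq, rfl, rfl, hw0⟩ := hΦ
    obtain rfl : p = .rfind' q := encodeCode_inj (by rw [hpq, encodeCode_rfind])
    refine ⟨.rfind' q, a, l, v, ?_, mem_eval_rfind_succ hw0 he' he, ?_⟩ <;>
      simp [Represents, rfindSuccRule, judgementRule, Rule.Psi, Expr.eval, lookup_cons, *]

/-- The invariant of the pool generated for the code `p`: judgements are true, queries are about `p`,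
and the target label occurs only if `p` halts on the input `0`. -/
def Sound (p : Code) : Pool I :=
  {i | (i.id = ι 0 → Correct ι i.map) ∧
    (i.id = ι 1 → i.map (ι 0) = some (.inl (encodeCode p))) ∧
    (i.id = ι 2 → (p.eval 0).Dom)}

theorem interp_haltingSpec_subset (p : Code) :
    Spec.interp (haltingSpec ι) (haltingTrace ι p) ⊆ Sound ι p := by
  refine Spec.interp_subset ?_ fun δ hδ => ?_
  · rintro i ⟨ev, hev, hid, -, -, hm⟩
    simp only [haltingTrace, List.mem_cons, List.not_mem_nil, or_false] at hev
    rcases hev with rfl | rfl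
    · simp [Sound, hid, hm, MapData.toMap, encodeCode_eq]
    · refine ⟨fun _ => ⟨.zero, 0, 0, 0, ?_, ?_, ?_⟩, ?_, ?_⟩ <;>
        simp [Represents, hid, hm, MapData.toMap, lookup_cons, encodeCode, Code.eval, pure, PFun.pure]
  · rintro i ⟨i₁, h₁, i₂, h₂, hid, hid₁, hid₂, -, hΦ, hm⟩
    rcases List.mem_cons.mp hδ with rfl | hδ
    · refine ⟨by simp [hid, targetRule], by simp [hid, targetRule], fun _ => ?_⟩
      have hp := h₁.2.1 hid₁
      obtain ⟨q, a, k, v, ⟨hq, ha, hk, hv⟩, he, -⟩ := h₂.1 hid₂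
      simp [Rule.Phi, targetRule, Expr.eval, Op.apply, hp, hq, ha, hk] at hΦ
      obtain ⟨hpq, h0⟩ := hΦ
      obtain rfl := encodeCode_inj hpq
      rw [h0] at he
      exact Part.dom_iff_mem.mpr ⟨v, he⟩
    · have hids : δ.id = ι 0 ∧ δ.id₁ = ι 0 ∧ δ.id₂ = ι 0 := by
        simp only [evalRules, List.mem_cons, List.not_mem_nil, or_false] at hδ
        rcases hδ with rfl | rfl | rfl | rfl | rfl | rfl | rfl | rfl | rfl | rfl <;>
          exact ⟨rfl, rfl, rfl⟩
      rw [hids.1] at hid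
      refine ⟨fun _ => ?_, by simp [hid], by simp [hid]⟩
      rw [hm]
      exact correct_psi ι hδ (h₁.1 (hid₁.trans hids.2.1)) (h₂.1 (hid₂.trans hids.2.2)) hΦ

end Soundness

/-! ### Completeness of the reduction -/

section Completeness

variable {I : Type} [DecidableEq I] (ι : Fin 5 ↪ I)

/-- The judgement `p (Nat.pair a k) = v` is represented in the pool `π` at time `0`. -/
def Derived (π : Pool I) (p : Code) (a k v : ℕ) : Prop :=
  ∃ m, Interval.atZero (ι 0) m ∈ π ∧ Represents ι m p a k v

variable {ι}

theorem Derived.target {p : Code} {v : ℕ}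
    (h : Derived ι (Spec.interp (haltingSpec ι) (haltingTrace ι p)) p 0 0 v) :
    Evaluation (haltingInstance ι p) := by
  obtain ⟨m, hm, hp, ha, hk, hv⟩ := h
  refine ⟨_, Spec.atZero_mem_interp (δ := targetRule ι)
    (m₁ := MapData.toMap [(ι 0, .inl (Encodable.encode p))]) List.mem_cons_self rfl
    (Spec.init_subset_interp _ _ ⟨_, List.mem_cons_self, rfl, rfl, rfl, rfl⟩) hm ?_, rfl⟩
  simp [Rule.Phi, targetRule, MapData.toMap, Expr.eval, Op.apply, encodeCode_eq, Nat.pair, *]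

variable {τ : Trace I}

local notation "𝒫" => Spec.interp (haltingSpec ι) τ

theorem psi_mem {δ : Rule I} (hδ : δ ∈ evalRules ι) {m₁ m₂ : Map I}
    (h₁ : Interval.atZero (ι 0) m₁ ∈ 𝒫) (h₂ : Interval.atZero (ι 0) m₂ ∈ 𝒫)
    (hΦ : δ.Phi m₁ m₂) : Interval.atZero (ι 0) (δ.Psi m₁ m₂) ∈ 𝒫 := by
  have hδ' : δ ∈ haltingSpec ι := List.mem_cons_of_mem _ hδ
  simp only [evalRules, List.mem_cons, List.not_mem_nil, or_false] at hδ
  rcases hδ with rfl | rfl | rfl | rfl | rfl | rfl | rfl | rfl | rfl | rfl <;>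
    exact Spec.atZero_mem_interp hδ' rfl h₁ h₂ hΦ

/-- The rules for the four basic codes: they apply to any two numbers that occur as values. -/
theorem Derived.basic {p q : Code} {a k v b l w : ℕ} (h₁ : Derived ι 𝒫 p a k v)
    (h₂ : Derived ι 𝒫 q b l w) :
    Derived ι 𝒫 .zero v w 0 ∧ Derived ι 𝒫 .succ v w (Nat.pair v w + 1) ∧
      Derived ι 𝒫 .left v w v ∧ Derived ι 𝒫 .right v w w := by
  obtain ⟨m₁, h₁, hp, ha, hk, hv⟩ := h₁
  obtain ⟨m₂, h₂, hq, hb, hl, hw⟩ := h₂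
  refine ⟨⟨_, psi_mem (δ := zeroRule ι) (by simp [evalRules]) h₁ h₂ rfl, ?_⟩,
    ⟨_, psi_mem (δ := succRule ι) (by simp [evalRules]) h₁ h₂ rfl, ?_⟩,
    ⟨_, psi_mem (δ := leftRule ι) (by simp [evalRules]) h₁ h₂ rfl, ?_⟩,
    ⟨_, psi_mem (δ := rightRule ι) (by simp [evalRules]) h₁ h₂ rfl, ?_⟩⟩ <;>
  simp [Represents, zeroRule, succRule, leftRule, rightRule, judgementRule, Rule.Psi, Expr.eval,
    Op.apply, encodeCode, lookup_cons, hv, hw]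

theorem Derived.pair {f g : Code} {a k x y : ℕ} (h₁ : Derived ι 𝒫 f a k x)
    (h₂ : Derived ι 𝒫 g a k y) : Derived ι 𝒫 (.pair f g) a k (Nat.pair x y) := by
  obtain ⟨m₁, h₁, hp, ha, hk, hv⟩ := h₁
  obtain ⟨m₂, h₂, hq, hb, hl, hw⟩ := h₂
  refine ⟨_, psi_mem (δ := pairRule ι) (by simp [evalRules]) h₁ h₂ ?_, ?_⟩
  · simp [Rule.Phi, pairRule, judgementRule, Expr.eval, Op.apply, *]
  · simp [Represents, pairRule, judgementRule, Rule.Psi, Expr.eval, Op.apply, encodeCode_pair,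
      lookup_cons, *]

theorem Derived.comp {f g : Code} {a k b l v : ℕ} (h₁ : Derived ι 𝒫 g a k (Nat.pair b l))
    (h₂ : Derived ι 𝒫 f b l v) : Derived ι 𝒫 (.comp f g) a k v := by
  obtain ⟨m₁, h₁, hp, ha, hk, hv⟩ := h₁
  obtain ⟨m₂, h₂, hq, hb, hl, hw⟩ := h₂
  refine ⟨_, psi_mem (δ := compRule ι) (by simp [evalRules]) h₁ h₂ ?_, ?_⟩
  · simp [Rule.Phi, compRule, judgementRule, Expr.eval, Op.apply, *]
  · simp [Represents, compRule, judgementRule, Rule.Psi, Expr.eval, Op.apply, encodeCode_comp,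
      lookup_cons, *]

/-- The judgement `prec f g (Nat.pair a k) = v` is represented in the pool `π` at time `0`, together
with the number of `g` at the key `ι 4`. -/
def DerivedPrec (ι : Fin 5 ↪ I) (π : Pool I) (f g : Code) (a k v : ℕ) : Prop :=
  ∃ m, Interval.atZero (ι 0) m ∈ π ∧ Represents ι m (.prec f g) a k v ∧
    m (ι 4) = some (.inl (encodeCode g))

theorem DerivedPrec.derived {f g : Code} {a k v : ℕ} (h : DerivedPrec ι 𝒫 f g a k v) :
    Derived ι 𝒫 (.prec f g) a k v :=
  let ⟨m, hm, hr, _⟩ := h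
  ⟨m, hm, hr⟩

theorem Derived.prec_zero {f g q : Code} {a k v b l : ℕ} (h₁ : Derived ι 𝒫 f a k v)
    (h₂ : Derived ι 𝒫 q b l (encodeCode g)) : DerivedPrec ι 𝒫 f g (Nat.pair a k) 0 v := by
  obtain ⟨m₁, h₁, hp, ha, hk, hv⟩ := h₁
  obtain ⟨m₂, h₂, hq, hb, hl, hw⟩ := h₂
  refine ⟨_, psi_mem (δ := precZeroRule ι) (by simp [evalRules]) h₁ h₂ rfl, ?_, ?_⟩
  · simp [Represents, precZeroRule, judgementRule, Rule.Psi, Expr.eval, Op.apply, encodeCode_prec,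
      lookup_cons, *]
  · simp [precZeroRule, judgementRule, Rule.Psi, Expr.eval, lookup_cons, *]

theorem DerivedPrec.succ {f g : Code} {a k x v : ℕ} (h₁ : DerivedPrec ι 𝒫 f g a k x)
    (h₂ : Derived ι 𝒫 g a (Nat.pair k x) v) : DerivedPrec ι 𝒫 f g a (k + 1) v := by
  obtain ⟨m₁, h₁, ⟨hp, ha, hk, hv⟩, hu⟩ := h₁
  obtain ⟨m₂, h₂, hq, hb, hl, hw⟩ := h₂
  refine ⟨_, psi_mem (δ := precSuccRule ι) (by simp [evalRules]) h₁ h₂ ?_, ?_, ?_⟩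
  · simp [Rule.Phi, precSuccRule, judgementRule, Expr.eval, Op.apply, *]
  all_goals
    simp [Represents, precSuccRule, judgementRule, Rule.Psi, Expr.eval, Op.apply, lookup_cons, *]

theorem Derived.rfind_zero {f : Code} {a k : ℕ} (h : Derived ι 𝒫 f a k 0) :
    Derived ι 𝒫 (.rfind' f) a k k := by
  obtain ⟨m, h, hp, ha, hk, hv⟩ := h
  refine ⟨_, psi_mem (δ := rfindZeroRule ι) (by simp [evalRules]) h h ?_, ?_⟩
  · simp [Rule.Phi, rfindZeroRule, judgementRule, Expr.eval, Op.apply, *]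
  · simp [Represents, rfindZeroRule, judgementRule, Rule.Psi, Expr.eval, Op.apply, encodeCode_rfind,
      lookup_cons, *]

theorem Derived.rfind_succ {f : Code} {a k v w : ℕ} (h₁ : Derived ι 𝒫 (.rfind' f) a (k + 1) v)
    (h₂ : Derived ι 𝒫 f a k w) (hw0 : 0 < w) : Derived ι 𝒫 (.rfind' f) a k v := by
  obtain ⟨m₁, h₁, hp, ha, hk, hv⟩ := h₁
  obtain ⟨m₂, h₂, hq, hb, hl, hw⟩ := h₂
  refine ⟨_, psi_mem (δ := rfindSuccRule ι) (by simp [evalRules]) h₁ h₂ ?_, ?_⟩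
  · simp [Rule.Phi, rfindSuccRule, judgementRule, Expr.eval, Op.apply, encodeCode_rfind, *]
  · simp [Represents, rfindSuccRule, judgementRule, Rule.Psi, Expr.eval, lookup_cons, *]

/-- Every number is the value of a judgement: `Nat.pair a k + 1` is the value of `succ` at an input
whose components `a` and `k` are smaller. -/
theorem exists_value (h0 : Derived ι 𝒫 .zero 0 0 0) (n : ℕ) : ∃ p a k, Derived ι 𝒫 p a k n := by
  induction n using Nat.strong_induction_on with
  | _ n ih =>
    rcases n with _ | n
    · exact ⟨_, _, _, h0⟩
    · obtain ⟨p, a, k, h₁⟩ := ih n.unpair.1 (Nat.lt_succ_of_le n.unpair_left_le)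
      obtain ⟨q, b, l, h₂⟩ := ih n.unpair.2 (Nat.lt_succ_of_le n.unpair_right_le)
      have h := (h₁.basic h₂).2.1
      rw [Nat.pair_unpair] at h
      exact ⟨_, _, _, h⟩

theorem derived_basic (h0 : Derived ι 𝒫 .zero 0 0 0) (a k : ℕ) :
    Derived ι 𝒫 .zero a k 0 ∧ Derived ι 𝒫 .succ a k (Nat.pair a k + 1) ∧
      Derived ι 𝒫 .left a k a ∧ Derived ι 𝒫 .right a k k := by
  obtain ⟨_, _, _, ha⟩ := exists_value h0 a
  obtain ⟨_, _, _, hk⟩ := exists_value h0 k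
  exact ha.basic hk

theorem derived_of_mem_eval (h0 : Derived ι 𝒫 .zero 0 0 0) {p : Code} {a k v : ℕ}
    (h : v ∈ p.eval (Nat.pair a k)) : Derived ι 𝒫 p a k v := by
  induction p generalizing a k v with
  | zero =>
    obtain rfl : v = 0 := by simpa [Code.eval, pure, PFun.pure] using h
    exact (derived_basic h0 a k).1
  | succ =>
    obtain rfl : v = Nat.pair a k + 1 := by simpa [Code.eval] using h
    exact (derived_basic h0 a k).2.1
  | left =>
    obtain rfl : v = a := by simpa [Code.eval] using h
    exact (derived_basic h0 v k).2.2.1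
  | right =>
    obtain rfl : v = k := by simpa [Code.eval] using h
    exact (derived_basic h0 a v).2.2.2
  | pair f g ihf ihg =>
    obtain ⟨x, hx, y, hy, rfl⟩ := mem_eval_pair.mp h
    exact (ihf hx).pair (ihg hy)
  | comp f g ihf ihg =>
    obtain ⟨x, hx, hv⟩ := mem_eval_comp.mp h
    rw [← Nat.pair_unpair x] at hx hv
    exact (ihg hx).comp (ihf hv)
  | prec f g ihf ihg =>
    refine DerivedPrec.derived ?_
    induction k generalizing v with
    | zero =>
      -- The input `a` of `f` has to be in paired form to be the input of a judgement.
      rw [eval_prec_zero, ← Nat.pair_unpair a] at h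
      obtain ⟨_, _, _, hg⟩ := exists_value h0 (encodeCode g)
      simpa using (ihf h).prec_zero hg
    | succ k ih =>
      obtain ⟨x, hx, hv⟩ := mem_eval_prec_succ.mp h
      exact (ih hx).succ (ihg hv)
  | rfind' f ih =>
    obtain ⟨j, rfl, hj, hpos⟩ := mem_eval_rfind.mp h
    clear h
    induction j generalizing k with
    | zero => simpa using (ih hj).rfind_zero
    | succ j ihj =>
      obtain ⟨w, hw0, hw⟩ := hpos 0 j.succ_pos
      rw [show j + 1 + k = j + (k + 1) by ring] at hj ⊢
      refine Derived.rfind_succ (ihj hj fun i hi => ?_) (ih (by simpa using hw)) hw0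
      rw [show i + (k + 1) = i + 1 + k by ring]
      exact hpos (i + 1) (by omega)

end Completeness

/-! ### Undecidability -/

theorem evaluation_haltingInstance {I : Type} [DecidableEq I] (ι : Fin 5 ↪ I) (p : Code) :
    Evaluation (haltingInstance ι p) ↔ (p.eval 0).Dom := by
  constructor
  · rintro ⟨i, hi, hid⟩
    exact (interp_haltingSpec_subset ι p hi).2.2 hid
  · intro h
    obtain ⟨v, hv⟩ := Part.dom_iff_mem.mp h
    refine Derived.target (v := v)
      (derived_of_mem_eval ?_ (by simpa [Nat.pair] using hv))
    refine ⟨MapData.toMap [(ι 0, .inl 0), (ι 1, .inl 0), (ι 2, .inl 0), (ι 3, .inl 0)],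
      Spec.init_subset_interp _ _
        ⟨_, List.mem_cons_of_mem _ List.mem_cons_self, rfl, rfl, rfl, rfl⟩, ?_⟩
    simp [Represents, MapData.toMap, lookup_cons, encodeCode]

theorem computable_haltingInstance {I : Type} [Primcodable I] (ι : Fin 5 ↪ I) :
    Computable (haltingInstance ι) := by
  refine Primrec.to_comp (Primrec.pair (Primrec.const _) (Primrec.pair ?_ (Primrec.const _)))
  refine Primrec.list_cons.comp (Primrec.pair (Primrec.const _) (Primrec.pair (Primrec.const _) ?_))
    (Primrec.const _)
  exact Primrec.list_cons.comp
    (Primrec.pair (Primrec.const _) (Primrec.sumInl.comp Primrec.encode)) (Primrec.const _)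

theorem not_computablePred_evaluation {I : Type} [DecidableEq I] [Primcodable I]
    (ι : Fin 5 ↪ I) :
    ¬ ComputablePred (fun x : Instance I => Evaluation x) := fun h =>
  ComputablePred.halting_problem 0 <| h.computable_of_manyOneReducible
    ⟨haltingInstance ι, computable_haltingInstance ι,
      fun p => (evaluation_haltingInstance ι p).symm⟩

end Nfer

/-- The evaluation problem for inclusive nfer is undecidable: both when the instances draw their
(finitely many) identifiers from a countable supply, and for some fixed finite set of
identifiers. -/
theorem theorem1 :
    ¬ ComputablePred (fun x : Nfer.Instance ℕ => Nfer.Evaluation x) ∧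
    ∃ n : ℕ, ¬ ComputablePred (fun x : Nfer.Instance (Fin n) => Nfer.Evaluation x) :=
  ⟨Nfer.not_computablePred_evaluation Fin.valEmbedding,
    5, Nfer.not_computablePred_evaluation (Function.Embedding.refl _)⟩
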